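/- Let $\Delta$ be a nondegenerate ideal tetrahedron in hyperbolic $3$-space $\mathbb{H}^3$, with ideal vertices numbered $0,1,2,3$ so that, seen from vertex $0$, the vertices $1,2,3$ appear in anticlockwise order (equivalently, an orientation-preserving isometry takes the vertices $0,1,2,3$ to $0,\infty,z,1\in\partial\mathbb{H}^3=\mathbb{C}\cup\{\infty\}$ with $\operatorname{Im} z>0$). *Shape parameters.* The shape parameter $z_{ij}$ of $\Delta$ along the edge $ij$ is the complex number $z$ such that, if an orientation-preserving isometry places the two endpoints of the edge at $0$ and $\infty$ and the remaining two ideal vertices at $1$ and at a point with positive imaginary part, then this last point is $z$. *Spin-decorated horospheres.* Frames are right-handed orthonormal frames; spin frames are the points of the double (universal) cover of the bundle of frames of $\mathbb{H}^3$. Let $v$ be a unit parallel tangent vector field on a horosphere $H$, and let $N^{out}$ and $N^{in}=-N^{out}$ be the unit normals of $H$ pointing towards and away from its centre. A spin decoration $W=(W^{in},W^{out})$ on $H$ consists of continuous lifts to spin frames of the frame fields $(N^{in},v,N^{in}\times v)$ and $(N^{out},v,N^{out}\times v)$ for some such $v$, where $W^{in}$ is obtained from $W^{out}$ by a rotation of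 angle $\pi$ about $v$ at each point. *Complex lambda lengths.* Let $(H_1,W_1),(H_2,W_2)$ be spin-decorated horospheres with distinct centres, let $\gamma$ be the geodesic oriented from the centre of $H_1$ to that of $H_2$, and let $p_i=\gamma\cap H_i$. The complex lambda length from $(H_1,W_1)$ to $(H_2,W_2)$ is $\exp(d/2)$, where $d=\rho+i\theta$ (well defined modulo $4\pi i$) is such that a translation along $\gamma$ of signed distance $\rho$ followed by a rotation about $\gamma$ of angle $\theta$ takes the spin frame $W_1^{in}(p_1)$ to the spin frame $W_2^{out}(p_2)$. If the centres agree, the complex lambda length is $0$. **Proposition.** For each $i$ choose any spin-decorated horosphere $(H_i,W_i)$ centred at the ideal vertex $i$ of $\Delta$, and let $\lambda_{ij}$ be the complex lambda length from $(H_i,W_i)$ to $(H_j,W_j)$. Then the shape parameters $z_{ij}$ and the complex lambda lengths $\lambda_{ij}$ are well defined, and $$z_{01}=z_{23}=\frac{\lambda_{02}\lambda_{13}}{\lambda_{03}\lambda_{12}},\qquad z_{02}=z_{13}=-\frac{\lambda_{03}\lambda_{12}}{\lambda_{01}\lambda_{23}},\qquad z_{03}=z_{12}=\frac{\lambda_{01}\lambda_{23}}{\lambda_{02}\lambda_{13}}.$$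 -/

import Mathlib

open scoped Matrix MatrixGroups

noncomputable section

namespace SpinHyperbolic

/-! ### Minkowski space, hyperbolic space and the action of `SL(2, ℂ)` -/

/-- Minkowski space `ℝ^{1,3}` with coordinates `(T, X, Y, Z)`. -/
abbrev Minkowski : Type := Fin 4 → ℝ

/-- The Lorentzian form of signature `(+,-,-,-)`. -/
def mink (x y : Minkowski) : ℝ := x 0 * y 0 - x 1 * y 1 - x 2 * y 2 - x 3 * y 3

/-- The hyperboloid model of hyperbolic 3-space. -/
def hyperbolicSpace : Set Minkowski := {x | mink x x = 1 ∧ 0 < x 0}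

/-- The future light cone `L⁺`. -/
def futureLightCone : Set Minkowski := {x | mink x x = 0 ∧ 0 < x 0}

/-- The Hermitian matrix `½ (T + Z, X + iY; X - iY, T - Z)` of a point of Minkowski space. -/
def toHermitian (x : Minkowski) : Matrix (Fin 2) (Fin 2) ℂ :=
  !![((x 0 + x 3 : ℝ) : ℂ) / 2, ((x 1 : ℂ) + (x 2 : ℂ) * Complex.I) / 2;
     ((x 1 : ℂ) - (x 2 : ℂ) * Complex.I) / 2, ((x 0 - x 3 : ℝ) : ℂ) / 2]

/-- The inverse of `toHermitian` on Hermitian matrices. -/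
def ofHermitian (M : Matrix (Fin 2) (Fin 2) ℂ) : Minkowski :=
  ![(M 0 0 + M 1 1).re, 2 * (M 0 1).re, 2 * (M 0 1).im, (M 0 0 - M 1 1).re]

/-- The action of `SL(2, ℂ)` on Minkowski space, `S ↦ A S A*` on Hermitian matrices. It is the
standard identification of `PSL(2, ℂ)` with the orientation-preserving isometries of `ℍ³`. -/
def act (A : SL(2, ℂ)) (x : Minkowski) : Minkowski :=
  ofHermitian ((A : Matrix (Fin 2) (Fin 2) ℂ) * toHermitian x *
    (A : Matrix (Fin 2) (Fin 2) ℂ)ᴴ)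

theorem toHermitian_ofHermitian {M : Matrix (Fin 2) (Fin 2) ℂ} (hM : M.IsHermitian) :
    toHermitian (ofHermitian M) = M := by
  have h00 : (M 0 0).im = 0 := by
    have := congrArg Complex.im (hM.apply 0 0); simp at this; linarith
  have h11 : (M 1 1).im = 0 := by
    have := congrArg Complex.im (hM.apply 1 1); simp at this; linarith
  have h10 := hM.apply 1 0
  ext i j
  fin_cases i <;> fin_cases j <;>
    simp [toHermitian, ofHermitian, ← h10, Complex.ext_iff, h00, h11]; ring_nf

theorem isHermitian_toHermitian (x : Minkowski) : (toHermitian x).IsHermitian := by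
  ext i j
  fin_cases i <;> fin_cases j <;>
    simp [toHermitian, Complex.ext_iff]

theorem toHermitian_act (A : SL(2, ℂ)) (x : Minkowski) :
    toHermitian (act A x) = (A : Matrix (Fin 2) (Fin 2) ℂ) * toHermitian x *
      (A : Matrix (Fin 2) (Fin 2) ℂ)ᴴ :=
  toHermitian_ofHermitian (Matrix.isHermitian_mul_mul_conjTranspose _ (isHermitian_toHermitian x))

theorem ofHermitian_toHermitian (x : Minkowski) : ofHermitian (toHermitian x) = x := by
  ext i
  fin_cases i <;> simp [toHermitian, ofHermitian] <;> ring

theorem act_add (A : SL(2, ℂ)) (x y : Minkowski) : act A (x + y) = act A x + act A y := by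
  have h : toHermitian (x + y) = toHermitian x + toHermitian y := by
    ext i j
    fin_cases i <;> fin_cases j <;> simp [toHermitian] <;> ring
  have h' (M N : Matrix (Fin 2) (Fin 2) ℂ) :
      ofHermitian (M + N) = ofHermitian M + ofHermitian N := by
    ext i
    fin_cases i <;> simp [ofHermitian] <;> ring
  rw [act, h, mul_add, add_mul, h']; rfl

theorem mink_self (x : Minkowski) : (mink x x : ℂ) = 4 * (toHermitian x).det := by
  simp [Matrix.det_fin_two, toHermitian, mink]
  linear_combination -(x 2 : ℂ) ^ 2 * Complex.I_sq

theorem mink_act (A : SL(2, ℂ)) (x y : Minkowski) : mink (act A x) (act A y) = mink x y := by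
  have hself (x : Minkowski) : mink (act A x) (act A x) = mink x x := by
    have h : (mink (act A x) (act A x) : ℂ) = mink x x := by
      rw [mink_self, mink_self, toHermitian_act]
      simp
    exact_mod_cast h
  have hp (x y : Minkowski) : mink x y = (mink (x + y) (x + y) - mink x x - mink y y) / 2 := by
    simp [mink]; ring
  rw [hp, ← act_add, hself, hself, hself, ← hp]

/-! ### Frames and spin frames -/

/-- A right-handed orthonormal frame `(f₁, f₂, f₃) = (dir 0, dir 1, dir 2)` at the point `pt` of
hyperbolic 3-space. In particular `f₃ = f₁ × f₂` is determined by `pt`, `f₁` and `f₂`. -/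
@[ext]
structure Frame where
  pt : Minkowski
  dir : Fin 3 → Minkowski
  pt_mem : pt ∈ hyperbolicSpace
  tangent : ∀ i, mink pt (dir i) = 0
  orthonormal : ∀ i j, mink (dir i) (dir j) = if i = j then -1 else 0
  right_handed : 0 < (Matrix.of ![pt, dir 0, dir 1, dir 2]).det

/-- Spin frames. The group `SL(2, ℂ)` acts simply transitively on them, and a choice of base spin
frame identifies the spin double cover `Frˢ → Fr` with the double cover `SL(2, ℂ) → Fr` that sends
`A` to the image under `A` of the base frame, see `SpinFrame.frame`. -/
abbrev SpinFrame : Type := SL(2, ℂ)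

/-- The three vectors `∂_Z, ∂_Y, -∂_X` of the base frame at the point `(1, 0, 0, 0)`. -/
def baseDir : Fin 3 → Minkowski := ![![0, 0, 0, 1], ![0, 0, 1, 0], ![0, -1, 0, 0]]

theorem act_mem_hyperbolicSpace (A : SL(2, ℂ)) :
    act A ![1, 0, 0, 0] ∈ hyperbolicSpace := by
  refine ⟨by rw [mink_act]; simp [mink], ?_⟩
  have hd : (A 0 0 : ℂ) * A 1 1 - A 0 1 * A 1 0 = 1 := by
    have := A.det_coe
    rwa [Matrix.det_fin_two] at this
  have h : act A ![1, 0, 0, 0] 0 = (Complex.normSq (A 0 0) + Complex.normSq (A 0 1) +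
      Complex.normSq (A 1 0) + Complex.normSq (A 1 1)) / 2 := by
    simp [act, ofHermitian, toHermitian, Matrix.mul_apply, Fin.sum_univ_two, Complex.normSq_apply]
    ring
  rw [h]
  have h1 := Complex.normSq_nonneg (A 0 0)
  have h2 := Complex.normSq_nonneg (A 0 1)
  have h3 := Complex.normSq_nonneg (A 1 0)
  have h4 := Complex.normSq_nonneg (A 1 1)
  by_contra hcon
  have e1 : A 0 0 = 0 := Complex.normSq_eq_zero.1 (by linarith)
  have e2 : A 0 1 = 0 := Complex.normSq_eq_zero.1 (by linarith)
  simp [e1, e2] at hd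

theorem det_act_base (A : SL(2, ℂ)) :
    (Matrix.of ![act A ![1, 0, 0, 0], act A (baseDir 0), act A (baseDir 1),
      act A (baseDir 2)]).det = 1 := by
  let Q : Matrix (Fin 4) (Fin 4) ℂ :=
    !![1, 0, 0, 1; 0, 1, 1, 0; 0, Complex.I, -Complex.I, 0; 1, 0, 0, -1]
  let N : Matrix (Fin 4) (Fin 4) ℂ :=
    !![A 0 0 * star (A 0 0), A 0 0 * star (A 1 0), A 1 0 * star (A 0 0), A 1 0 * star (A 1 0);
       A 0 0 * star (A 0 1), A 0 0 * star (A 1 1), A 1 0 * star (A 0 1), A 1 0 * star (A 1 1);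
       A 0 1 * star (A 0 0), A 0 1 * star (A 1 0), A 1 1 * star (A 0 0), A 1 1 * star (A 1 0);
       A 0 1 * star (A 0 1), A 0 1 * star (A 1 1), A 1 1 * star (A 0 1), A 1 1 * star (A 1 1)]
  let K : Matrix (Fin 4) (Fin 4) ℂ :=
    !![1, 0, 0, 1; 1, 0, 0, -1; 0, Complex.I, -Complex.I, 0; 0, -1, -1, 0]
  let R := Matrix.of ![act A ![1, 0, 0, 0], act A (baseDir 0), act A (baseDir 1),
      act A (baseDir 2)]
  have hrow (x : Minkowski) (j : Fin 4) : ∑ k, ((act A x k : ℝ) : ℂ) * Q k j =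
      2 * ![toHermitian (act A x) 0 0, toHermitian (act A x) 0 1,
        toHermitian (act A x) 1 0, toHermitian (act A x) 1 1] j := by
    fin_cases j <;> simp [Q, Fin.sum_univ_four, toHermitian] <;> ring
  have hRQ : R.map Complex.ofReal * Q = K * N := by
    ext i j
    have : (R.map Complex.ofReal * Q) i j = ∑ k, ((R i k : ℝ) : ℂ) * Q k j := by
      simp [Matrix.mul_apply]
    rw [this]
    fin_cases i
    · refine (hrow _ j).trans ?_
      rw [toHermitian_act]
      fin_cases j <;> simp [K, N, Matrix.mul_apply, Fin.sum_univ_four, Fin.sum_univ_two,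
        toHermitian] <;> ring
    · refine (hrow _ j).trans ?_
      rw [toHermitian_act]
      fin_cases j <;> simp [K, N, Matrix.mul_apply, Fin.sum_univ_four, Fin.sum_univ_two,
        toHermitian, baseDir] <;> ring
    · refine (hrow _ j).trans ?_
      rw [toHermitian_act]
      fin_cases j <;> simp [K, N, Matrix.mul_apply, Fin.sum_univ_four, Fin.sum_univ_two,
        toHermitian, baseDir] <;> ring
    · refine (hrow _ j).trans ?_
      rw [toHermitian_act]
      fin_cases j <;> simp [K, N, Matrix.mul_apply, Fin.sum_univ_four, Fin.sum_univ_two,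
        toHermitian, baseDir] <;> ring
  have hd : (A 0 0 : ℂ) * A 1 1 - A 0 1 * A 1 0 = 1 := by
    have := A.det_coe
    rwa [Matrix.det_fin_two] at this
  have hd' : star (A 0 0 : ℂ) * star (A 1 1) - star (A 0 1) * star (A 1 0) = 1 := by
    have := congrArg star hd
    simpa using this
  have hN : N.det = 1 := by
    have : N.det = ((A 0 0 : ℂ) * A 1 1 - A 0 1 * A 1 0) ^ 2 *
        (star (A 0 0 : ℂ) * star (A 1 1) - star (A 0 1) * star (A 1 0)) ^ 2 := by
      generalize hN : N = N'
      rw [Matrix.det_succ_row_zero]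
      simp only [Fin.sum_univ_four, Matrix.det_fin_three, Matrix.submatrix_apply, ← hN, N]
      simp [Fin.succAbove, Fin.succ, Fin.castSucc]
      ring
    rw [this, hd, hd']; norm_num
  have hQ : Q.det = 4 * Complex.I := by
    rw [Matrix.det_succ_row_zero]
    simp [Fin.sum_univ_four, Matrix.det_fin_three, Q, Fin.succAbove, Fin.succ, Fin.castSucc]
    ring
  have hK : K.det = 4 * Complex.I := by
    rw [Matrix.det_succ_row_zero]
    simp [Fin.sum_univ_four, Matrix.det_fin_three, K, Fin.succAbove, Fin.succ, Fin.castSucc]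
    ring
  have hdet := congrArg Matrix.det hRQ
  rw [Matrix.det_mul, Matrix.det_mul, hQ, hK, hN, mul_one] at hdet
  have h4 : (4 * Complex.I) ≠ 0 := by simp
  have h1 : (R.map Complex.ofReal).det = 1 := mul_right_cancel₀ h4 (by rw [hdet, one_mul])
  have h2 : ((R.det : ℝ) : ℂ) = (R.map Complex.ofReal).det :=
    RingHom.map_det Complex.ofRealHom R
  rw [h1] at h2
  exact_mod_cast h2

/-- The frame underlying a spin frame. -/
def SpinFrame.frame (A : SpinFrame) : Frame where
  pt := act A ![1, 0, 0, 0]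
  dir i := act A (baseDir i)
  pt_mem := act_mem_hyperbolicSpace A
  tangent i := by
    rw [mink_act]
    fin_cases i <;> simp [mink, baseDir]
  orthonormal i j := by
    rw [mink_act]
    fin_cases i <;> fin_cases j <;> simp [mink, baseDir]
  right_handed := by rw [det_act_base]; exact one_pos

/-- `F'` is obtained from `F` by the translation of signed length `ρ` along the geodesic through
`F.pt` that is oriented by the first vector of `F`. -/
def IsTranslate (ρ : ℝ) (F F' : Frame) : Prop :=
  F'.pt = Real.cosh ρ • F.pt + Real.sinh ρ • F.dir 0 ∧
  F'.dir 0 = Real.sinh ρ • F.pt + Real.cosh ρ • F.dir 0 ∧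
  F'.dir 1 = F.dir 1 ∧ F'.dir 2 = F.dir 2

/-- `F'` is obtained from `F` by the rotation of angle `θ` about the `i`-th vector of `F`, the sign
of the angle being given by the right-hand rule (indices are cyclic modulo 3). -/
def IsRotate (i : Fin 3) (θ : ℝ) (F F' : Frame) : Prop :=
  F'.pt = F.pt ∧ F'.dir i = F.dir i ∧
  F'.dir (i + 1) = Real.cos θ • F.dir (i + 1) + Real.sin θ • F.dir (i + 2) ∧
  F'.dir (i + 2) = -Real.sin θ • F.dir (i + 1) + Real.cos θ • F.dir (i + 2)

/-- Translation of spin frames: the path of frames translated by `tρ`, `0 ≤ t ≤ 1`, lifts to a path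
of spin frames from `W` to `W'`. -/
def IsSpinTranslate (ρ : ℝ) (W W' : SpinFrame) : Prop :=
  ∃ c : Path W W', ∀ t : unitInterval,
    IsTranslate ((t : ℝ) * ρ) (SpinFrame.frame W) (SpinFrame.frame (c t))

/-- Rotation of spin frames: the path of frames rotated by `tθ`, `0 ≤ t ≤ 1`, lifts to a path
of spin frames from `W` to `W'`. -/
def IsSpinRotate (i : Fin 3) (θ : ℝ) (W W' : SpinFrame) : Prop :=
  ∃ c : Path W W', ∀ t : unitInterval,
    IsRotate i ((t : ℝ) * θ) (SpinFrame.frame W) (SpinFrame.frame (c t))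

/-- `d = ρ + iθ` is a complex distance from `W` to `W'`: a translation of signed distance `ρ` along
the oriented geodesic to which `W` is adapted (the one directed by its first vector), followed by a
rotation of angle `θ` about this geodesic, takes `W` to `W'`. -/
def IsComplexDistance (W W' : SpinFrame) (d : ℂ) : Prop :=
  ∃ W'' : SpinFrame, IsSpinTranslate d.re W W'' ∧ IsSpinRotate 0 d.im W'' W'

/-! ### Spin-decorated horospheres and complex lambda lengths -/

/-- The horosphere of a point `p` of the future light cone. Every horosphere is of this form for
exactly one `p`. -/
def horosphere (p : Minkowski) : Set Minkowski := {x | x ∈ hyperbolicSpace ∧ mink x p = 1}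

/-- A horosphere decorated by a unit tangent vector field `v` which is parallel, that is, invariant
under all parabolic isometries that preserve the horosphere (equivalently, that fix `p`). -/
structure DecoratedHorosphere where
  p : Minkowski
  p_mem : p ∈ futureLightCone
  v : horosphere p → Minkowski
  tangent : ∀ q : horosphere p, mink (q : Minkowski) (v q) = 0 ∧ mink p (v q) = 0
  unit : ∀ q, mink (v q) (v q) = -1
  parallel : ∀ A : SL(2, ℂ), (A : Matrix (Fin 2) (Fin 2) ℂ).IsParabolic → act A p = p →
    ∀ q q' : horosphere p, (q' : Minkowski) = act A q → v q' = act A (v q)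

/-- The unit normal of the horosphere of `p` at `q` which points towards the centre. -/
def outwardNormal (p q : Minkowski) : Minkowski := p - q

/-- The unit normal of the horosphere of `p` at `q` which points away from the centre. -/
def inwardNormal (p q : Minkowski) : Minkowski := q - p

/-- A spin-decorated horosphere: continuous lifts `Win`, `Wout` to spin frames of the inward frame
field `(N^in, v, N^in × v)` and the outward frame field `(N^out, v, N^out × v)` of a decorated
horosphere, such that rotating `Wout` by `π` about `v` gives `Win`. -/
structure SpinDecoratedHorosphere extends DecoratedHorosphere where
  Win : horosphere p → SpinFrame
  Wout : horosphere p → SpinFrame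
  continuous_Win : Continuous Win
  continuous_Wout : Continuous Wout
  lift_Win : ∀ q : horosphere p, (SpinFrame.frame (Win q)).pt = q ∧
    (SpinFrame.frame (Win q)).dir 0 = inwardNormal p q ∧ (SpinFrame.frame (Win q)).dir 1 = v q
  lift_Wout : ∀ q : horosphere p, (SpinFrame.frame (Wout q)).pt = q ∧
    (SpinFrame.frame (Wout q)).dir 0 = outwardNormal p q ∧ (SpinFrame.frame (Wout q)).dir 1 = v q
  associated : ∀ q, IsSpinRotate 1 Real.pi (Wout q) (Win q)

open Classical in
/-- The point of `∂ℍ³ = ℂ ∪ {∞}` on the ray of the light cone through `p`: the light cone projects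
to the unit sphere, which is identified with `ℂ ∪ {∞}` by `(x, y, z) ↦ (x + iy) / (1 - z)`. -/
def boundaryPoint (p : Minkowski) : OnePoint ℂ :=
  if p 0 = p 3 then OnePoint.infty
  else (((p 1 : ℂ) + (p 2 : ℂ) * Complex.I) / ((p 0 : ℂ) - (p 3 : ℂ)) : ℂ)

/-- The centre of a spin-decorated horosphere, in `∂ℍ³ = ℂ ∪ {∞}`. -/
def SpinDecoratedHorosphere.centre (D : SpinDecoratedHorosphere) : OnePoint ℂ := boundaryPoint D.p

/-- The geodesic of `ℍ³` joining the points at infinity of two rays of the light cone. -/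
def geodesic (p p' : Minkowski) : Set Minkowski :=
  {x | x ∈ hyperbolicSpace ∧ ∃ a b : ℝ, x = a • p + b • p'}

/-- `l` is the complex lambda length from `D` to `E`. It is zero if the centres agree; otherwise
it is `exp (d / 2)`, where `d` is the complex distance from the inward spin frame of `D` to the
outward spin frame of `E` at the points where the geodesic joining the centres meets the
horospheres. These frames are both adapted to the geodesic oriented from `D` to `E`. -/
def IsComplexLambdaLength (D E : SpinDecoratedHorosphere) (l : ℂ) : Prop :=
  (D.centre = E.centre ∧ l = 0) ∨
  (D.centre ≠ E.centre ∧ ∃ (q : horosphere D.p) (q' : horosphere E.p) (d : ℂ),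
    (q : Minkowski) ∈ geodesic D.p E.p ∧ (q' : Minkowski) ∈ geodesic D.p E.p ∧
    IsComplexDistance (D.Win q) (E.Wout q') d ∧ l = Complex.exp (d / 2))

/-! ### Ideal tetrahedra and shape parameters -/

/-- The inverse of `(x, y, z) ↦ (x + iy) / (1 - z)`, from `ℂ ∪ {∞}` to the unit sphere. -/
def toSphere : OnePoint ℂ → (Fin 3 → ℝ)
  | none => ![0, 0, 1]
  | some w => ![2 * w.re / (Complex.normSq w + 1), 2 * w.im / (Complex.normSq w + 1),
      (Complex.normSq w - 1) / (Complex.normSq w + 1)]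

/-- The ideal tetrahedron with ideal vertices `v 0, v 1, v 2, v 3` is nondegenerate, and seen from
vertex `0` the vertices `1, 2, 3` appear in anticlockwise order. In the projective model, where the
ideal tetrahedron is the Euclidean tetrahedron inscribed in the unit sphere, this says that the
vector `(v 2 - v 1) × (v 3 - v 1)` points to the side of vertex `0`. -/
def PositivelyNumbered (v : Fin 4 → OnePoint ℂ) : Prop :=
  0 < (toSphere (v 0) - toSphere (v 1)) ⬝ᵥ
    ((toSphere (v 2) - toSphere (v 1)) ⨯₃ (toSphere (v 3) - toSphere (v 1)))

/-- `z` is the shape parameter along the edge `ij` of the ideal tetrahedron with ideal vertices `v`: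
some orientation-preserving isometry (a Möbius transformation of `∂ℍ³ = ℂ ∪ {∞}`) places the
endpoints of the edge at `0` and `∞`, and the two other vertices at `1` and at the point `z`
with positive imaginary part. -/
def IsShapeParameter (v : Fin 4 → OnePoint ℂ) (i j : Fin 4) (z : ℂ) : Prop :=
  0 < z.im ∧ ∃ (g : GL (Fin 2) ℂ) (k l : Fin 4), [i, j, k, l].Nodup ∧
    ((g • v i = ((0 : ℂ) : OnePoint ℂ) ∧ g • v j = OnePoint.infty) ∨
      (g • v i = OnePoint.infty ∧ g • v j = ((0 : ℂ) : OnePoint ℂ))) ∧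
    g • v k = ((1 : ℂ) : OnePoint ℂ) ∧ g • v l = (z : OnePoint ℂ)

end SpinHyperbolic

end

noncomputable section

namespace SpinHyperbolic

/-! ### Spin frames with the same underlying frame -/

/-! Everything reduces to linear algebra on ℂ². Spin frames are matrices in SL(2, ℂ), and moving a
frame relative to itself is right multiplication. Unique lifting for the double cover
(`lift_unique`) replaces the path definitions by algebra: a complex translation by `d` is
multiplication by diag(e^{d/2}, e^{-d/2}) (`isComplexDistance_iff`).

Since the decorating field is parallel, the outward spin frames of a horosphere are the matrices A·U
with U unipotent upper triangular, so they share their first column κ, the spinor of the horosphere.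
The horosphere corresponds to the Hermitian matrix κκ*, and its centre is κ₀/κ₁. An inward frame has
columns η and -κ, where η is the second column of the outward frame, so det(κ, η) = 1. If this
inward frame is carried by `d` to an outward frame with spinor κ', then κ' = e^{d/2} η, hence det(κ,
κ') = e^{d/2}. Thus λ is the symplectic product of the spinors (`isComplexLambdaLength_iff`).

Shape parameters are cross-ratios of the centres, hence ratios of such products. What remains is to
choose the labelling with positive imaginary part. The triple product defining the numbering fixes
it for one edge (`triple_product_toSphere`), and the Plücker relation passes it on to the others. -/

theorem toHermitian_injective : Function.Injective toHermitian :=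
  Function.LeftInverse.injective ofHermitian_toHermitian

theorem act_mul (A B : SL(2, ℂ)) (x : Minkowski) : act (A * B) x = act A (act B x) := by
  apply toHermitian_injective
  simp only [toHermitian_act, Matrix.SpecialLinearGroup.coe_mul, Matrix.conjTranspose_mul,
    Matrix.mul_assoc]

theorem act_one (x : Minkowski) : act 1 x = x := by
  apply toHermitian_injective
  simp [toHermitian_act]

theorem det_entries (A : SL(2, ℂ)) : A 0 0 * A 1 1 - A 0 1 * A 1 0 = 1 := by
  have := A.det_coe
  rwa [Matrix.det_fin_two] at this

theorem toHermitian_base : toHermitian ![1, 0, 0, 0] = !![1 / 2, 0; 0, 1 / 2] := by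
  simp [toHermitian]

theorem toHermitian_baseDir_zero : toHermitian (baseDir 0) = !![1 / 2, 0; 0, -1 / 2] := by
  simp [toHermitian, baseDir]

theorem toHermitian_baseDir_one :
    toHermitian (baseDir 1) = !![0, Complex.I / 2; -Complex.I / 2, 0] := by
  simp [toHermitian, baseDir]

/-- The base frame is stabilised only by `±1`. -/
theorem entries_of_act_base_eq (C : SL(2, ℂ)) (h : act C ![1, 0, 0, 0] = ![1, 0, 0, 0])
    (h0 : act C (baseDir 0) = baseDir 0) (h1 : act C (baseDir 1) = baseDir 1) :
    C 0 1 = 0 ∧ C 1 0 = 0 ∧ C 1 1 = C 0 0 ∧ C 0 0 ^ 2 = 1 := by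
  have e := toHermitian_act C ![1, 0, 0, 0]
  have e0 := toHermitian_act C (baseDir 0)
  have e1 := toHermitian_act C (baseDir 1)
  rw [h, toHermitian_base] at e
  rw [h0, toHermitian_baseDir_zero] at e0
  rw [h1, toHermitian_baseDir_one] at e1
  have hd := det_entries C
  have a00 := congrFun (congrFun e 0) 0
  have a11 := congrFun (congrFun e 1) 1
  have b00 := congrFun (congrFun e0 0) 0
  have b11 := congrFun (congrFun e0 1) 1
  have c01 := congrFun (congrFun e1 0) 1
  simp [Matrix.mul_apply, Fin.sum_univ_two] at a00 a11 b00 b11 c01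
  -- The base point and `baseDir 0` have matrices diag(½, ±½); combining the two equations isolates
  -- |C₀₁|² and |C₁₀|². The remaining vector `baseDir 1` then compares the phases of the diagonal
  -- entries.
  have hb : C 0 1 = 0 := by
    have : C 0 1 * (starRingEnd ℂ) (C 0 1) = 0 := by linear_combination b00 - a00
    simpa using this
  have hc : C 1 0 = 0 := by
    have : C 1 0 * (starRingEnd ℂ) (C 1 0) = 0 := by linear_combination -b11 - a11
    simpa using this
  have hcd : C 0 0 * (starRingEnd ℂ) (C 1 1) = 1 := by
    have hI := Complex.I_ne_zero
    rw [hb] at c01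
    field_simp at c01
    linear_combination -c01
  have hdd : C 1 1 * (starRingEnd ℂ) (C 1 1) = 1 := by
    rw [hc] at a11
    linear_combination -2 * a11
  rw [hb] at hd
  have hda : C 1 1 = C 0 0 := by
    linear_combination C 0 0 * hdd - C 1 1 * hcd
  refine ⟨hb, hc, hda, ?_⟩
  rw [hda] at hd
  linear_combination hd

/-- Two continuous lifts to spin frames of the same field of frames, on a connected space, agree
if they agree at a point. -/
theorem lift_unique {X : Type*} [TopologicalSpace X] [PreconnectedSpace X] {f g : X → SL(2, ℂ)}
    (hf : Continuous f) (hg : Continuous g)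
    (h : ∀ x, act (f x) ![1, 0, 0, 0] = act (g x) ![1, 0, 0, 0])
    (h0 : ∀ x, act (f x) (baseDir 0) = act (g x) (baseDir 0))
    (h1 : ∀ x, act (f x) (baseDir 1) = act (g x) (baseDir 1))
    {x₀ : X} (hx : f x₀ = g x₀) (x : X) : f x = g x := by
  have key (x : X) := entries_of_act_base_eq ((g x)⁻¹ * f x)
    (by rw [act_mul, h, ← act_mul, inv_mul_cancel, act_one])
    (by rw [act_mul, h0, ← act_mul, inv_mul_cancel, act_one])
    (by rw [act_mul, h1, ← act_mul, inv_mul_cancel, act_one])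
  have hcont : Continuous fun x ↦ ((g x)⁻¹ * f x) 0 0 :=
    (continuous_apply_apply (0 : Fin 2) (0 : Fin 2)).comp
      (Continuous.subtype_val (p := fun M : Matrix (Fin 2) (Fin 2) ℂ ↦ M.det = 1) (hg.inv.mul hf))
  -- The diagonal entry is continuous with square 1 on a connected space, so its sign is constant.
  have h00 : ((g x)⁻¹ * f x) 0 0 = 1 :=
    (isPreconnected_univ (α := X)).eq_of_sq_eq (g := fun _ ↦ (1 : ℂ)) hcont.continuousOn
      continuousOn_const (fun x _ ↦ by simpa using (key x).2.2.2) (fun _ ↦ one_ne_zero)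
      (Set.mem_univ x₀) (by simp [hx]) (Set.mem_univ x)
  have hone : (g x)⁻¹ * f x = 1 := by
    obtain ⟨k1, k2, k3, -⟩ := key x
    ext i j
    fin_cases i <;> fin_cases j
    · simpa using h00
    · simpa using k1
    · simpa using k2
    · simpa [h00] using k3
  rw [inv_mul_eq_one] at hone
  exact hone.symm

/-! ### Translations and rotations of spin frames -/

/-- The one-parameter subgroup `diag (e^{d/2}, e^{-d/2})`. -/
def diagExp (d : ℂ) : SL(2, ℂ) :=
  ⟨!![Complex.exp (d / 2), 0; 0, Complex.exp (-(d / 2))], by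
    rw [Matrix.det_fin_two_of, ← Complex.exp_add]; simp⟩

/-- The rotation of `ℂ²` of angle `θ / 2`, that covers the rotation of angle `θ` about the second
vector of the base frame. -/
def halfRotation (θ : ℝ) : SL(2, ℂ) :=
  ⟨!![(Real.cos (θ / 2) : ℂ), -(Real.sin (θ / 2) : ℂ); (Real.sin (θ / 2) : ℂ),
    (Real.cos (θ / 2) : ℂ)], by
    rw [Matrix.det_fin_two_of]
    have := Real.cos_sq_add_sin_sq (θ / 2)
    have h : ((Real.cos (θ / 2) ^ 2 + Real.sin (θ / 2) ^ 2 : ℝ) : ℂ) = 1 := by rw [this]; simp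
    push_cast at h ⊢
    linear_combination h⟩

theorem coe_diagExp (d : ℂ) : (diagExp d : Matrix (Fin 2) (Fin 2) ℂ) =
    !![Complex.exp (d / 2), 0; 0, Complex.exp (-(d / 2))] := rfl

theorem coe_halfRotation (θ : ℝ) : (halfRotation θ : Matrix (Fin 2) (Fin 2) ℂ) =
    !![(Real.cos (θ / 2) : ℂ), -(Real.sin (θ / 2) : ℂ); (Real.sin (θ / 2) : ℂ),
      (Real.cos (θ / 2) : ℂ)] := rfl

theorem continuous_diagExp : Continuous diagExp := by
  refine Continuous.subtype_mk (continuous_matrix fun i j ↦ ?_) _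
  fin_cases i <;> fin_cases j <;> simp <;> fun_prop

theorem continuous_halfRotation : Continuous halfRotation := by
  refine Continuous.subtype_mk (continuous_matrix fun i j ↦ ?_) _
  fin_cases i <;> fin_cases j <;> simp <;> fun_prop

theorem act_smul (A : SL(2, ℂ)) (r : ℝ) (x : Minkowski) : act A (r • x) = r • act A x := by
  have h (y : Minkowski) : toHermitian (r • y) = (r : ℂ) • toHermitian y := by
    ext i j
    fin_cases i <;> fin_cases j <;> simp [toHermitian] <;> ring
  apply toHermitian_injective
  rw [toHermitian_act, h, h, toHermitian_act]
  simp

theorem diagExp_zero : diagExp 0 = 1 := by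
  ext i j
  fin_cases i <;> fin_cases j <;> simp [diagExp]

theorem halfRotation_zero : halfRotation 0 = 1 := by
  ext i j
  fin_cases i <;> fin_cases j <;> simp [halfRotation]

theorem diagExp_add (d e : ℂ) : diagExp (d + e) = diagExp d * diagExp e := by
  apply Subtype.ext
  rw [Matrix.SpecialLinearGroup.coe_mul, coe_diagExp, coe_diagExp, coe_diagExp, Matrix.mul_fin_two,
    add_div, neg_add, Complex.exp_add, Complex.exp_add]
  simp

/-- The frame of `A * B` is the image under `A` of the frame of `B`, and `act A` is linear, so it
suffices to treat the base frame. There the claim is polynomial in e^{±ρ/2}. -/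
theorem isTranslate_mul_diagExp (A : SL(2, ℂ)) (ρ : ℝ) :
    IsTranslate ρ (SpinFrame.frame A) (SpinFrame.frame (A * diagExp ρ)) := by
  have hE : (Complex.exp (ρ / 2)) = (Real.exp (ρ / 2) : ℂ) := by push_cast; rfl
  have hE' : (Complex.exp (-(ρ / 2))) = (Real.exp (-(ρ / 2)) : ℂ) := by push_cast; rfl
  have h1 : Real.exp (ρ / 2) * Real.exp (-(ρ / 2)) = 1 := by rw [← Real.exp_add]; simp
  have h2 : Real.cosh ρ = (Real.exp (ρ / 2) ^ 2 + Real.exp (-(ρ / 2)) ^ 2) / 2 := by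
    rw [Real.cosh_eq, ← Real.exp_nat_mul, ← Real.exp_nat_mul]; ring_nf
  have h3 : Real.sinh ρ = (Real.exp (ρ / 2) ^ 2 - Real.exp (-(ρ / 2)) ^ 2) / 2 := by
    rw [Real.sinh_eq, ← Real.exp_nat_mul, ← Real.exp_nat_mul]; ring_nf
  refine ⟨?_, ?_, ?_, ?_⟩
  all_goals
    simp only [SpinFrame.frame, act_mul, ← act_smul, ← act_add]
    congr 1
    rw [act, coe_diagExp, hE, hE']
    generalize Real.exp (ρ / 2) = a at *
    generalize Real.exp (-(ρ / 2)) = b at *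
    try simp only [h2, h3]
    ext i
    fin_cases i <;>
      simp [ofHermitian, toHermitian, baseDir, Matrix.mul_apply, Fin.sum_univ_two] <;>
      first | ring1 | linear_combination h1 | linear_combination -h1

theorem isRotate_mul_diagExp (A : SL(2, ℂ)) (θ : ℝ) :
    IsRotate 0 θ (SpinFrame.frame A) (SpinFrame.frame (A * diagExp (θ * Complex.I))) := by
  have hE : Complex.exp (θ * Complex.I / 2) =
      Real.cos (θ / 2) + Real.sin (θ / 2) * Complex.I := by
    rw [Complex.ofReal_cos, Complex.ofReal_sin, ← Complex.exp_mul_I]; congr 1; push_cast; ring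
  have hE' : Complex.exp (-(θ * Complex.I / 2)) =
      Real.cos (θ / 2) - Real.sin (θ / 2) * Complex.I := by
    have := Complex.exp_mul_I (-(θ / 2 : ℂ))
    rw [Complex.cos_neg, Complex.sin_neg] at this
    push_cast
    rw [sub_eq_add_neg, ← neg_mul, ← this]; congr 1; ring
  have h1 := Real.cos_sq_add_sin_sq (θ / 2)
  have h2 : Real.cos θ = Real.cos (θ / 2) ^ 2 - Real.sin (θ / 2) ^ 2 := by
    rw [← Real.cos_two_mul']; ring_nf
  have h3 : Real.sin θ = 2 * Real.sin (θ / 2) * Real.cos (θ / 2) := by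
    rw [← Real.sin_two_mul]; ring_nf
  refine ⟨?_, ?_, ?_, ?_⟩
  all_goals
    simp only [SpinFrame.frame, act_mul, ← act_smul, ← act_add]
    congr 1
    rw [act, coe_diagExp, hE, hE']
    try simp only [h2, h3]
    generalize Real.cos (θ / 2) = a at *
    generalize Real.sin (θ / 2) = b at *
    ext i
    fin_cases i <;>
      simp [ofHermitian, toHermitian, baseDir, Matrix.mul_apply, Fin.sum_univ_two] <;>
      first | ring1 | linear_combination h1

theorem isRotate_mul_halfRotation (A : SL(2, ℂ)) (θ : ℝ) :
    IsRotate 1 θ (SpinFrame.frame A) (SpinFrame.frame (A * halfRotation θ)) := by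
  have h1 := Real.cos_sq_add_sin_sq (θ / 2)
  have h2 : Real.cos θ = Real.cos (θ / 2) ^ 2 - Real.sin (θ / 2) ^ 2 := by
    rw [← Real.cos_two_mul']; ring_nf
  have h3 : Real.sin θ = 2 * Real.sin (θ / 2) * Real.cos (θ / 2) := by
    rw [← Real.sin_two_mul]; ring_nf
  refine ⟨?_, ?_, ?_, ?_⟩
  all_goals
    simp only [SpinFrame.frame, act_mul, ← act_smul, ← act_add]
    congr 1
    rw [act, coe_halfRotation]
    try simp only [h2, h3]
    generalize Real.cos (θ / 2) = a at *
    generalize Real.sin (θ / 2) = b at *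
    ext i
    fin_cases i <;>
      simp [ofHermitian, toHermitian, baseDir, Matrix.mul_apply, Fin.sum_univ_two] <;>
      first | ring1 | linear_combination h1

/-- Unique path lifting: the model path `A * f t` starts at the same spin frame and covers the same
frames, so it has the same endpoint. -/
theorem path_target_eq {A B : SL(2, ℂ)} (c : Path A B) {f : ℝ → SL(2, ℂ)} (hf : Continuous f)
    (hf0 : f 0 = 1)
    (h : ∀ t : unitInterval, (SpinFrame.frame (c t)).pt = (SpinFrame.frame (A * f t)).pt ∧
      (SpinFrame.frame (c t)).dir 0 = (SpinFrame.frame (A * f t)).dir 0 ∧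
      (SpinFrame.frame (c t)).dir 1 = (SpinFrame.frame (A * f t)).dir 1) : B = A * f 1 := by
  have := lift_unique (f := c) (g := fun t : unitInterval ↦ A * f t) c.continuous
    (continuous_const.mul (hf.comp continuous_subtype_val))
    (fun t ↦ (h t).1) (fun t ↦ (h t).2.1) (fun t ↦ (h t).2.2) (x₀ := 0) (by simp [hf0]) 1
  simpa using this

theorem isSpinTranslate_iff {ρ : ℝ} {A B : SL(2, ℂ)} :
    IsSpinTranslate ρ A B ↔ B = A * diagExp ρ := by
  constructor
  · rintro ⟨c, hc⟩
    have := path_target_eq c (f := fun t ↦ diagExp ((t * ρ : ℝ) : ℂ))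
      (continuous_diagExp.comp (by fun_prop)) (by simp [diagExp_zero]) fun t ↦ by
        obtain ⟨h1, h2, h3, -⟩ := hc t
        obtain ⟨k1, k2, k3, -⟩ := isTranslate_mul_diagExp A (t * ρ)
        exact ⟨h1.trans k1.symm, h2.trans k2.symm, h3.trans k3.symm⟩
    simpa using this
  · rintro rfl
    refine ⟨⟨⟨fun t ↦ A * diagExp ((t * ρ : ℝ) : ℂ), ?_⟩, ?_, ?_⟩, fun t ↦ ?_⟩
    · exact continuous_const.mul (continuous_diagExp.comp (by fun_prop))
    · simp [diagExp_zero]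
    · simp
    · exact isTranslate_mul_diagExp A (t * ρ)

theorem isSpinRotate_zero_iff {θ : ℝ} {A B : SL(2, ℂ)} :
    IsSpinRotate 0 θ A B ↔ B = A * diagExp (θ * Complex.I) := by
  constructor
  · rintro ⟨c, hc⟩
    have := path_target_eq c (f := fun t ↦ diagExp ((t * θ : ℝ) * Complex.I))
      (continuous_diagExp.comp (by fun_prop)) (by simp [diagExp_zero]) fun t ↦ by
        obtain ⟨h1, h2, h3, -⟩ := hc t
        obtain ⟨k1, k2, k3, -⟩ := isRotate_mul_diagExp A (t * θ)
        exact ⟨h1.trans k1.symm, h2.trans k2.symm, h3.trans k3.symm⟩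
    simpa using this
  · rintro rfl
    refine ⟨⟨⟨fun t ↦ A * diagExp ((t * θ : ℝ) * Complex.I), ?_⟩, ?_, ?_⟩, fun t ↦ ?_⟩
    · exact continuous_const.mul (continuous_diagExp.comp (by fun_prop))
    · simp [diagExp_zero]
    · simp
    · exact isRotate_mul_diagExp A (t * θ)

theorem IsSpinRotate.eq_mul_halfRotation {θ : ℝ} {A B : SL(2, ℂ)} (h : IsSpinRotate 1 θ A B) :
    B = A * halfRotation θ := by
  obtain ⟨c, hc⟩ := h
  have := path_target_eq c (f := fun t ↦ halfRotation (t * θ))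
    (continuous_halfRotation.comp (by fun_prop)) (by simp [halfRotation_zero]) fun t ↦ by
      obtain ⟨h1, h2, -, h4⟩ := hc t
      obtain ⟨k1, k2, -, k4⟩ := isRotate_mul_halfRotation A (t * θ)
      -- Indices are modulo 3: for rotation about vector 1, the last clause of `IsRotate` concerns
      -- vector 1 + 2 = 0.
      exact ⟨h1.trans k1.symm, h4.trans k4.symm, h2.trans k2.symm⟩
  simpa using this

theorem isComplexDistance_iff {A B : SL(2, ℂ)} {d : ℂ} :
    IsComplexDistance A B d ↔ B = A * diagExp d := by
  simp only [IsComplexDistance, isSpinTranslate_iff, isSpinRotate_zero_iff, exists_eq_left]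
  rw [mul_assoc, ← diagExp_add, Complex.re_add_im]

/-! ### The spinor of a spin-decorated horosphere -/

theorem toHermitian_add (x y : Minkowski) :
    toHermitian (x + y) = toHermitian x + toHermitian y := by
  ext i j
  fin_cases i <;> fin_cases j <;> simp [toHermitian] <;> ring

/-- The future null vector of the spinor `(1, 0)`. -/
def baseNull : Minkowski := ![1, 0, 0, 1]

theorem base_add_baseDir_zero : ![1, 0, 0, 0] + baseDir 0 = baseNull := by
  ext i
  fin_cases i <;> simp [baseDir, baseNull]

theorem toHermitian_baseNull : toHermitian baseNull = !![1, 0; 0, 0] := by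
  simp [toHermitian, baseNull]

theorem toHermitian_act_baseNull (A : SL(2, ℂ)) (i j : Fin 2) :
    toHermitian (act A baseNull) i j = A i 0 * star (A j 0) := by
  rw [toHermitian_act, toHermitian_baseNull]
  simp [Matrix.mul_apply, Fin.sum_univ_two]

theorem mink_act_base_act_baseNull (A : SL(2, ℂ)) :
    mink (act A ![1, 0, 0, 0]) (act A baseNull) = 1 := by
  rw [mink_act]
  simp [mink, baseNull]

/-- The unipotent matrix with upper right entry `t`. -/
def unipotent (t : ℂ) : SL(2, ℂ) := ⟨!![1, t; 0, 1], by simp⟩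

theorem coe_unipotent (t : ℂ) : (unipotent t : Matrix (Fin 2) (Fin 2) ℂ) = !![1, t; 0, 1] := rfl

theorem unipotent_zero : unipotent 0 = 1 := by
  ext i j
  fin_cases i <;> fin_cases j <;> simp [unipotent]

theorem continuous_unipotent : Continuous unipotent := by
  refine Continuous.subtype_mk (continuous_matrix fun i j ↦ ?_) _
  fin_cases i <;> fin_cases j <;> simp <;> fun_prop

theorem act_unipotent_baseNull (t : ℂ) : act (unipotent t) baseNull = baseNull := by
  apply toHermitian_injective
  rw [toHermitian_act, toHermitian_baseNull, coe_unipotent]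
  ext i j
  fin_cases i <;> fin_cases j <;> simp [Matrix.mul_apply, Fin.sum_univ_two]

theorem isParabolic_conj_unipotent (A : SL(2, ℂ)) {t : ℂ} (ht : t ≠ 0) :
    ((A * unipotent t * A⁻¹ : SL(2, ℂ)) : Matrix (Fin 2) (Fin 2) ℂ).IsParabolic := by
  have h := Matrix.isParabolic_conj_iff (m := (unipotent t : Matrix (Fin 2) (Fin 2) ℂ))
    (A : GL (Fin 2) ℂ)
  have hu : (unipotent t : Matrix (Fin 2) (Fin 2) ℂ).IsParabolic := by
    rw [Matrix.isParabolic_iff_of_upperTriangular (by simp [coe_unipotent])]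
    simpa [coe_unipotent] using ht
  have := h.2 hu
  convert this using 1
  rw [Matrix.SpecialLinearGroup.coe_mul, Matrix.SpecialLinearGroup.coe_mul,
    ← Matrix.coe_units_inv, ← map_inv]
  rfl

/-- The stabiliser of the null vector consists of upper triangular matrices with diagonal (a, a⁻¹),
|a| = 1. Such a matrix is unipotent(ab)·diag(a, a⁻¹), with b the corner entry, and the diagonal
factor fixes the base point. -/
theorem exists_unipotent_act_base {C : SL(2, ℂ)} (hC : act C baseNull = baseNull) :
    ∃ t, act C ![1, 0, 0, 0] = act (unipotent t) ![1, 0, 0, 0] := by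
  have h (i j : Fin 2) := toHermitian_act_baseNull C i j
  rw [hC, toHermitian_baseNull] at h
  have h00 := h 0 0
  have h11 := h 1 1
  have hd := det_entries C
  simp at h00 h11
  rw [h11] at hd
  have h1 : star (C 1 1) = C 0 0 := by
    have := congrArg star hd
    simp at this
    simp only [RCLike.star_def]
    linear_combination C 0 0 * this + (starRingEnd ℂ) (C 1 1) * h00
  refine ⟨C 0 1 * C 0 0, ?_⟩
  apply toHermitian_injective
  rw [toHermitian_act, toHermitian_act, toHermitian_base, coe_unipotent, ← h1]
  have hd' : C 1 1 * (starRingEnd ℂ) (C 1 1) = 1 := by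
    simp only [RCLike.star_def] at h1
    rw [h1]; linear_combination hd
  ext i j
  fin_cases i <;> fin_cases j <;>
    simp [Matrix.mul_apply, Fin.sum_univ_two, h11]
  · linear_combination -h00 / 2 - C 0 1 * (starRingEnd ℂ) (C 0 1) / 2 * hd'
  · ring
  · ring
  · linear_combination hd' / 2

section

variable (D : SpinDecoratedHorosphere)

theorem SpinDecoratedHorosphere.p_eq (q : horosphere D.p) : D.p = act (D.Wout q) baseNull := by
  obtain ⟨h, h0, -⟩ := D.lift_Wout q
  rw [← base_add_baseDir_zero, act_add]
  change D.p = (SpinFrame.frame (D.Wout q)).pt + (SpinFrame.frame (D.Wout q)).dir 0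
  rw [h, h0, outwardNormal]
  abel

theorem SpinDecoratedHorosphere.act_mul_unipotent_mem (q : horosphere D.p) (t : ℂ) :
    act (D.Wout q * unipotent t) ![1, 0, 0, 0] ∈ horosphere D.p := by
  refine ⟨act_mem_hyperbolicSpace _, ?_⟩
  conv_lhs => rw [D.p_eq q, ← act_unipotent_baseNull t, ← act_mul]
  exact mink_act_base_act_baseNull _

/-- Conjugating the unipotent by the frame at `q` gives a parabolic isometry that preserves the
horosphere, so parallelism of `v` applies. The case t = 0 is separate because the identity is not
parabolic. -/
theorem SpinDecoratedHorosphere.v_act_mul_unipotent (q : horosphere D.p) (t : ℂ) :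
    D.v ⟨_, D.act_mul_unipotent_mem q t⟩ = act (D.Wout q * unipotent t) (baseDir 1) := by
  obtain ⟨h, -, h1⟩ := D.lift_Wout q
  change act (D.Wout q) ![1, 0, 0, 0] = q at h
  change act (D.Wout q) (baseDir 1) = D.v q at h1
  obtain rfl | ht := eq_or_ne t 0
  · simp only [unipotent_zero, mul_one, h, h1]
  · rw [D.parallel _ (isParabolic_conj_unipotent (D.Wout q) ht) ?_ q _ ?_, ← h1, ← act_mul]
    · simp
    · conv_lhs => rw [D.p_eq q, ← act_mul, inv_mul_cancel_right, act_mul, act_unipotent_baseNull]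
      exact (D.p_eq q).symm
    · rw [← h, ← act_mul]
      simp

/-- Both sides are continuous in t ∈ ℂ, lift the same frames, and agree at t = 0. -/
theorem SpinDecoratedHorosphere.Wout_act_mul_unipotent (q : horosphere D.p) (t : ℂ) :
    D.Wout ⟨_, D.act_mul_unipotent_mem q t⟩ = D.Wout q * unipotent t := by
  have hg : Continuous fun t ↦ D.Wout q * unipotent t :=
    continuous_const.mul continuous_unipotent
  have hact (x : Minkowski) : Continuous fun A : SL(2, ℂ) ↦ act A x := by
    have hA (i j : Fin 2) : Continuous fun A : SL(2, ℂ) ↦ A i j :=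
      (continuous_apply_apply i j).comp
        (Continuous.subtype_val (p := fun M : Matrix (Fin 2) (Fin 2) ℂ ↦ M.det = 1) continuous_id)
    refine continuous_pi fun i ↦ ?_
    have := hA 0 0
    have := hA 0 1
    have := hA 1 0
    have := hA 1 1
    fin_cases i <;> simp [act, ofHermitian, Matrix.mul_apply, Fin.sum_univ_two] <;> fun_prop
  refine lift_unique (f := fun t ↦ D.Wout ⟨_, D.act_mul_unipotent_mem q t⟩)
    (D.continuous_Wout.comp (((hact _).comp hg).subtype_mk _)) hg
    (fun t ↦ ?_) (fun t ↦ ?_) (fun t ↦ ?_) (x₀ := 0) ?_ t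
  · exact (D.lift_Wout ⟨_, D.act_mul_unipotent_mem q t⟩).1
  · refine (D.lift_Wout ⟨_, D.act_mul_unipotent_mem q t⟩).2.1.trans ?_
    have : D.p = act (D.Wout q * unipotent t) baseNull := by
      rw [act_mul, act_unipotent_baseNull]
      exact D.p_eq q
    rw [outwardNormal]
    dsimp only
    rw [sub_eq_iff_eq_add', ← act_add, base_add_baseDir_zero]
    exact this
  · exact (D.lift_Wout ⟨_, D.act_mul_unipotent_mem q t⟩).2.2.trans (D.v_act_mul_unipotent q t)
  · obtain ⟨h, -, -⟩ := D.lift_Wout q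
    change act (D.Wout q) ![1, 0, 0, 0] = q at h
    simp only [unipotent_zero, mul_one, h]

/-- Unipotents carry `q` to every point of the horosphere, and right multiplication by them
preserves the first column. -/
theorem SpinDecoratedHorosphere.Wout_column_eq (q q' : horosphere D.p) (i : Fin 2) :
    D.Wout q' i 0 = D.Wout q i 0 := by
  obtain ⟨h', -, -⟩ := D.lift_Wout q'
  change act (D.Wout q') ![1, 0, 0, 0] = q' at h'
  obtain ⟨t, ht⟩ := exists_unipotent_act_base (C := (D.Wout q)⁻¹ * D.Wout q') (by
    rw [act_mul, ← D.p_eq q', D.p_eq q, ← act_mul, inv_mul_cancel, act_one])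
  have hq : (q' : Minkowski) = act (D.Wout q * unipotent t) ![1, 0, 0, 0] := by
    rw [act_mul, ← ht, ← act_mul, mul_inv_cancel_left, h']
  have : q' = ⟨_, D.act_mul_unipotent_mem q t⟩ := Subtype.ext hq
  rw [this, D.Wout_act_mul_unipotent, Matrix.SpecialLinearGroup.coe_mul]
  simp [Matrix.mul_apply, Fin.sum_univ_two, coe_unipotent]

theorem horosphere_nonempty {p : Minkowski} (hp : p ∈ futureLightCone) :
    (horosphere p).Nonempty := by
  obtain ⟨h, h0⟩ := hp
  -- The point nearest the origin on the axis through it: p/2 + p'/⟨p, p'⟩, where p' is `p` with its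
  -- spatial part negated and ⟨p, p'⟩ = 2 p₀².
  refine ⟨![p 0 / 2 + 1 / (2 * p 0), p 1 / 2 - p 1 / (2 * p 0 ^ 2),
    p 2 / 2 - p 2 / (2 * p 0 ^ 2), p 3 / 2 - p 3 / (2 * p 0 ^ 2)], ⟨?_, ?_⟩, ?_⟩
  · simp [mink] at h ⊢
    field_simp
    linear_combination (p 0 ^ 4 - 2 * p 0 ^ 2 + 1) * h
  · simp; positivity
  · simp [mink] at h ⊢
    field_simp
    linear_combination (p 0 ^ 2 - 1) * h

/-- The spinor of a spin-decorated horosphere: the common first column of its outward spin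
frames. -/
def SpinDecoratedHorosphere.spinor (i : Fin 2) : ℂ :=
  D.Wout ⟨_, (horosphere_nonempty D.p_mem).some_mem⟩ i 0

theorem SpinDecoratedHorosphere.Wout_column (q : horosphere D.p) (i : Fin 2) :
    D.Wout q i 0 = D.spinor i :=
  D.Wout_column_eq _ q i

theorem SpinDecoratedHorosphere.toHermitian_p (i j : Fin 2) :
    toHermitian D.p i j = D.spinor i * star (D.spinor j) := by
  have h := toHermitian_act_baseNull (D.Wout ⟨_, (horosphere_nonempty D.p_mem).some_mem⟩) i j
  rwa [← D.p_eq] at h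

theorem SpinDecoratedHorosphere.Win_eq (q : horosphere D.p) (i : Fin 2) :
    D.Win q i 0 = D.Wout q i 1 ∧ D.Win q i 1 = -D.spinor i := by
  rw [(D.associated q).eq_mul_halfRotation, Matrix.SpecialLinearGroup.coe_mul]
  simp [Matrix.mul_apply, Fin.sum_univ_two, coe_halfRotation, D.Wout_column]

theorem SpinDecoratedHorosphere.wedge_spinor_Wout (q : horosphere D.p) :
    D.spinor 0 * D.Wout q 1 1 - D.spinor 1 * D.Wout q 0 1 = 1 := by
  have := det_entries (D.Wout q)
  rw [D.Wout_column, D.Wout_column] at this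
  linear_combination this

end

/-! ### Complex lambda lengths as symplectic products of spinors -/

/-- The symplectic form on `ℂ²`. -/
def wedge (x y : Fin 2 → ℂ) : ℂ := x 0 * y 1 - x 1 * y 0

theorem wedge_swap (x y : Fin 2 → ℂ) : wedge y x = -wedge x y := by
  simp [wedge]; ring

/-- The point `x 0 / x 1` of the projective line `ℂ ∪ {∞}`. -/
def ratio (x : Fin 2 → ℂ) : OnePoint ℂ :=
  if x 1 = 0 then OnePoint.infty else ((x 0 / x 1 : ℂ) : OnePoint ℂ)

theorem ratio_eq_iff {x y : Fin 2 → ℂ} (hx : x ≠ 0) (hy : y ≠ 0) :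
    ratio x = ratio y ↔ wedge x y = 0 := by
  have ne {z : Fin 2 → ℂ} (hz : z ≠ 0) (h : z 1 = 0) : z 0 ≠ 0 := fun h0 ↦
    hz (funext fun i ↦ by fin_cases i <;> simp [h0, h])
  by_cases h : x 1 = 0 <;> by_cases h' : y 1 = 0
  · simp [ratio, wedge, h, h']
  · simp [ratio, wedge, h, h', ne hx h]
  · simp [ratio, wedge, h, h', ne hy h']
  · simp [ratio, wedge, h, h', div_eq_div_iff, sub_eq_zero, mul_comm (x 1)]

theorem boundaryPoint_eq_ratio {p : Minkowski} {x : Fin 2 → ℂ}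
    (h : ∀ i j, toHermitian p i j = x i * star (x j)) : boundaryPoint p = ratio x := by
  have h11 := h 1 1
  have h01 := h 0 1
  simp [toHermitian] at h11 h01
  have h3 : (p 0 : ℂ) - p 3 = 2 * (x 1 * (starRingEnd ℂ) (x 1)) := by linear_combination 2 * h11
  have h12 : (p 1 : ℂ) + p 2 * Complex.I = 2 * (x 0 * (starRingEnd ℂ) (x 1)) := by
    linear_combination 2 * h01
  have hiff : p 0 = p 3 ↔ x 1 = 0 := by
    rw [← Complex.ofReal_inj, ← sub_eq_zero, h3]
    simp
  rw [boundaryPoint, ratio]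
  by_cases hx : x 1 = 0
  · rw [if_pos hx, if_pos (hiff.2 hx)]
  · rw [if_neg hx, if_neg (mt hiff.1 hx), h12, h3]
    have : (starRingEnd ℂ) (x 1) ≠ 0 := by simpa using hx
    congr 1
    field_simp

theorem mink_eq_toHermitian (x y : Minkowski) : (mink x y : ℂ) =
    2 * (toHermitian x 0 0 * toHermitian y 1 1 + toHermitian x 1 1 * toHermitian y 0 0 -
      toHermitian x 0 1 * toHermitian y 1 0 - toHermitian x 1 0 * toHermitian y 0 1) := by
  simp [toHermitian, mink]
  linear_combination -(x 2 * y 2 : ℂ) * Complex.I_sq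

theorem mink_eq_normSq_wedge {p p' : Minkowski} {x y : Fin 2 → ℂ}
    (h : ∀ i j, toHermitian p i j = x i * star (x j))
    (h' : ∀ i j, toHermitian p' i j = y i * star (y j)) :
    mink p p' = 2 * Complex.normSq (wedge x y) := by
  have := mink_eq_toHermitian p p'
  simp only [h, h'] at this
  rw [← Complex.ofReal_inj, this]
  push_cast
  rw [Complex.normSq_eq_conj_mul_self]
  simp [wedge]
  ring

theorem toHermitian_smul (r : ℝ) (x : Minkowski) :
    toHermitian (r • x) = (r : ℂ) • toHermitian x := by
  ext i j
  fin_cases i <;> fin_cases j <;> simp [toHermitian] <;> ring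

/-- The point of the horosphere of `p` on the geodesic from the centre of `p` to that of `p'`. -/
def footPoint (p p' : Minkowski) : Minkowski := (1 / 2 : ℝ) • p + (1 / mink p p') • p'

theorem footPoint_mem_horosphere {p p' : Minkowski} (hp : p ∈ futureLightCone)
    (hp' : p' ∈ futureLightCone) (h : 0 < mink p p') : footPoint p p' ∈ horosphere p := by
  have h0 := hp.2
  have h0' := hp'.2
  have hne := h.ne'
  have bilin (a b c d : ℝ) : mink (a • p + b • p') (c • p + d • p') =
      a * c * mink p p + (a * d + b * c) * mink p p' + b * d * mink p' p' := by
    simp [mink]; ring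
  -- For x = a p + b p' and m = ⟨p, p'⟩, the conditions ⟨x, p⟩ = bm = 1 and ⟨x, x⟩ = 2abm = 1 give b
  -- = 1/m and a = 1/2.
  refine ⟨⟨?_, ?_⟩, ?_⟩
  · rw [footPoint, bilin, hp.1, hp'.1]
    field_simp
    ring
  · simp [footPoint]; positivity
  · have := bilin (1 / 2) (1 / mink p p') 1 0
    rw [one_smul, zero_smul, add_zero, hp.1, hp'.1] at this
    rw [footPoint, this]
    field_simp
    ring

theorem footPoint_mem_geodesic {p p' : Minkowski} (hp : p ∈ futureLightCone)
    (hp' : p' ∈ futureLightCone) (h : 0 < mink p p') : footPoint p p' ∈ geodesic p p' :=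
  ⟨(footPoint_mem_horosphere hp hp' h).1, _, _, rfl⟩

theorem mink_comm (x y : Minkowski) : mink x y = mink y x := by
  simp [mink]; ring

theorem geodesic_comm (p p' : Minkowski) : geodesic p p' = geodesic p' p := by
  ext x
  constructor <;> rintro ⟨hx, a, b, h⟩ <;> exact ⟨hx, b, a, by rw [h, add_comm]⟩

section

variable (D E : SpinDecoratedHorosphere)

theorem SpinDecoratedHorosphere.spinor_ne_zero : D.spinor ≠ 0 := by
  intro h
  have := D.wedge_spinor_Wout ⟨_, (horosphere_nonempty D.p_mem).some_mem⟩
  simp [h] at this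

theorem SpinDecoratedHorosphere.centre_eq_ratio : D.centre = ratio D.spinor :=
  boundaryPoint_eq_ratio D.toHermitian_p

/-- The second column of the outward spin frame at the foot point of a geodesic. -/
theorem SpinDecoratedHorosphere.Wout_footPoint {p' : Minkowski} {y : Fin 2 → ℂ}
    (h' : ∀ i j, toHermitian p' i j = y i * star (y j)) (hy : wedge D.spinor y ≠ 0)
    (q : horosphere D.p) (hq : (q : Minkowski) = footPoint D.p p') (i : Fin 2) :
    D.Wout q i 1 = y i / wedge D.spinor y := by
  obtain ⟨h, -, -⟩ := D.lift_Wout q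
  change act (D.Wout q) ![1, 0, 0, 0] = q at h
  have hw := D.wedge_spinor_Wout q
  -- With columns κ, η of the frame, the foot point has matrix ½(κκ* + ηη*), but also ½κκ* + yy*/⟨p,
  -- p'⟩. Cancelling κκ* makes η proportional to `y`; the condition det(κ, η) = 1 then fixes the
  -- factor.
  have hprod (i j : Fin 2) : D.Wout q i 1 * star (D.Wout q j 1) =
      2 / (mink D.p p' : ℂ) * (y i * star (y j)) := by
    have e := toHermitian_act (D.Wout q) ![1, 0, 0, 0]
    rw [h, hq, footPoint, toHermitian_add, toHermitian_smul, toHermitian_smul,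
      toHermitian_base] at e
    have e' := congrFun (congrFun e i) j
    simp [Matrix.mul_apply, Fin.sum_univ_two, D.toHermitian_p, h', D.Wout_column] at e'
    simp only [RCLike.star_def]
    linear_combination -2 * e'
  have hzero : y 0 * D.Wout q 1 1 - y 1 * D.Wout q 0 1 = 0 := by
    have hj (j : Fin 2) : (y 0 * D.Wout q 1 1 - y 1 * D.Wout q 0 1) * star (D.Wout q j 1) = 0 := by
      linear_combination y 0 * hprod 1 j - y 1 * hprod 0 j
    by_contra hne
    have h0 := (mul_eq_zero.1 (hj 0)).resolve_left hne
    have h1 := (mul_eq_zero.1 (hj 1)).resolve_left hne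
    rw [star_eq_zero] at h0 h1
    simp [h0, h1] at hw
  rw [eq_div_iff hy, wedge]
  fin_cases i
  · simp
    linear_combination y 0 * hw - D.spinor 0 * hzero
  · simp
    linear_combination y 1 * hw - D.spinor 1 * hzero

/-- Comparing first columns in the relation of complex distance shows that any λ equals the
symplectic product. Existence uses the explicit frames at the two foot points. -/
theorem isComplexLambdaLength_iff (l : ℂ) :
    IsComplexLambdaLength D E l ↔ l = wedge D.spinor E.spinor := by
  have hc : D.centre = E.centre ↔ wedge D.spinor E.spinor = 0 := by
    rw [D.centre_eq_ratio, E.centre_eq_ratio, ratio_eq_iff D.spinor_ne_zero E.spinor_ne_zero]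
  rw [IsComplexLambdaLength, hc]
  constructor
  · rintro (⟨h, rfl⟩ | ⟨-, q, q', d, -, -, hd, rfl⟩)
    · exact h.symm
    · rw [isComplexDistance_iff] at hd
      have hcol (i : Fin 2) : E.spinor i = D.Wout q i 1 * Complex.exp (d / 2) := by
        rw [← E.Wout_column q' i, hd, Matrix.SpecialLinearGroup.coe_mul]
        simp [Matrix.mul_apply, Fin.sum_univ_two, coe_diagExp, (D.Win_eq q i).1]
      rw [wedge, hcol, hcol]
      linear_combination -Complex.exp (d / 2) * D.wedge_spinor_Wout q
  · rintro rfl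
    by_cases hw : wedge D.spinor E.spinor = 0
    · exact Or.inl ⟨hw, hw⟩
    have hw' : wedge E.spinor D.spinor ≠ 0 := by rwa [wedge_swap, neg_ne_zero]
    have hm : 0 < mink D.p E.p := by
      rw [mink_eq_normSq_wedge D.toHermitian_p E.toHermitian_p]
      have := Complex.normSq_pos.2 hw
      positivity
    have hm' : 0 < mink E.p D.p := by rwa [mink_comm]
    have hexp : Complex.exp (2 * Complex.log (wedge D.spinor E.spinor) / 2) =
        wedge D.spinor E.spinor := by
      rw [mul_div_cancel_left₀ _ two_ne_zero, Complex.exp_log hw]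
    refine Or.inr ⟨mt hc.1 hw, ⟨_, footPoint_mem_horosphere D.p_mem E.p_mem hm⟩,
      ⟨_, footPoint_mem_horosphere E.p_mem D.p_mem hm'⟩,
      2 * Complex.log (wedge D.spinor E.spinor), footPoint_mem_geodesic D.p_mem E.p_mem hm,
      geodesic_comm E.p D.p ▸ footPoint_mem_geodesic E.p_mem D.p_mem hm', ?_, hexp.symm⟩
    rw [isComplexDistance_iff]
    ext i j
    rw [Matrix.SpecialLinearGroup.coe_mul, coe_diagExp, Complex.exp_neg, hexp]
    have hD := D.Wout_footPoint E.toHermitian_p hw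
      ⟨_, footPoint_mem_horosphere D.p_mem E.p_mem hm⟩ rfl i
    have hE := E.Wout_footPoint D.toHermitian_p hw'
      ⟨_, footPoint_mem_horosphere E.p_mem D.p_mem hm'⟩ rfl i
    rw [wedge_swap D.spinor, div_neg, div_eq_mul_inv] at hE
    -- First columns match by the foot point formula for `D`, second columns by the one for `E`; the
    -- sign of -κ cancels the antisymmetry of `wedge`.
    fin_cases j
    · simp only [Matrix.mul_apply, Fin.sum_univ_two, (D.Win_eq _ _).1, E.Wout_column,
        Fin.zero_eta, hD]
      simp [hw]
    · simp only [Matrix.mul_apply, Fin.sum_univ_two, (D.Win_eq _ _).2, Fin.mk_one, hE]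
      simp

end

/-! ### Shape parameters as cross-ratios -/

theorem ratio_eq_infty_iff {x : Fin 2 → ℂ} : ratio x = OnePoint.infty ↔ x 1 = 0 := by
  by_cases h : x 1 = 0 <;> simp [ratio, h]

theorem ratio_eq_coe_iff {x : Fin 2 → ℂ} {z : ℂ} :
    ratio x = (z : OnePoint ℂ) ↔ x 1 ≠ 0 ∧ x 0 = z * x 1 := by
  by_cases h : x 1 = 0
  · simp [ratio, h]
  · simp [ratio, h, div_eq_iff]

theorem smul_ratio (g : GL (Fin 2) ℂ) {x : Fin 2 → ℂ} (hx : x ≠ 0) :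
    g • ratio x = ratio ((g : Matrix (Fin 2) (Fin 2) ℂ) *ᵥ x) := by
  rw [Matrix.mulVec_fin_two]
  by_cases h : x 1 = 0
  · have h0 : x 0 ≠ 0 := fun h0 ↦ hx (funext fun i ↦ by fin_cases i <;> simp [h0, h])
    rw [ratio_eq_infty_iff.2 h, OnePoint.smul_infty_eq_ite]
    by_cases h1 : g 1 0 = 0
    · simp [ratio, h, h1]
    · simp [ratio, h, h1, h0, mul_div_mul_right]
  · have h2 : g 1 0 * (x 0 / x 1) + g 1 1 = 0 ↔ g 1 0 * x 0 + g 1 1 * x 1 = 0 := by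
      have : g 1 0 * x 0 + g 1 1 * x 1 = (g 1 0 * (x 0 / x 1) + g 1 1) * x 1 := by field_simp
      rw [this, mul_eq_zero, or_iff_left h]
    rw [ratio, if_neg h, OnePoint.smul_some_eq_ite]
    by_cases h1 : g 1 0 * x 0 + g 1 1 * x 1 = 0
    · simp [ratio, h1, h2]
    · simp only [ratio, Matrix.cons_val_zero, Matrix.cons_val_one, h1, h2, if_false]
      rw [← mul_div_mul_right _ _ h]
      congr 2 <;> field_simp

theorem wedge_mulVec (g : Matrix (Fin 2) (Fin 2) ℂ) (x y : Fin 2 → ℂ) :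
    wedge (g *ᵥ x) (g *ᵥ y) = g.det * wedge x y := by
  simp [wedge, Matrix.det_fin_two]; ring

/-- The cross-ratio of four points of the projective line, equal to `z` for `0, ∞, 1, z`. -/
def crossRatio (a b c d : Fin 2 → ℂ) : ℂ := wedge a d * wedge b c / (wedge a c * wedge b d)

theorem crossRatio_swap_swap (a b c d : Fin 2 → ℂ) : crossRatio b a d c = crossRatio a b c d := by
  rw [crossRatio, crossRatio, mul_comm (wedge b c), mul_comm (wedge b d)]

theorem crossRatio_swap (a b c d : Fin 2 → ℂ) : crossRatio a b d c = (crossRatio a b c d)⁻¹ := by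
  rw [crossRatio, crossRatio, inv_div]

theorem crossRatio_mulVec {g : Matrix (Fin 2) (Fin 2) ℂ} (hg : g.det ≠ 0) (a b c d : Fin 2 → ℂ) :
    crossRatio (g *ᵥ a) (g *ᵥ b) (g *ᵥ c) (g *ᵥ d) = crossRatio a b c d := by
  simp only [crossRatio, wedge_mulVec]
  rw [mul_mul_mul_comm, mul_mul_mul_comm g.det (wedge a c),
    mul_div_mul_left _ _ (mul_ne_zero hg hg)]

theorem plucker (a b c d : Fin 2 → ℂ) :
    wedge a b * wedge c d = wedge a c * wedge b d - wedge a d * wedge b c := by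
  simp [wedge]; ring

theorem crossRatio_eq_of_ratio_eq {a b c d : Fin 2 → ℂ} (ha : a ≠ 0) (hb : b ≠ 0) (hc : c ≠ 0)
    (hd : d ≠ 0) {g : GL (Fin 2) ℂ} {z : ℂ} (ha' : g • ratio a = ((0 : ℂ) : OnePoint ℂ))
    (hb' : g • ratio b = OnePoint.infty) (hc' : g • ratio c = ((1 : ℂ) : OnePoint ℂ))
    (hd' : g • ratio d = (z : OnePoint ℂ)) : z = crossRatio a b c d := by
  have hdet : (g : Matrix (Fin 2) (Fin 2) ℂ).det ≠ 0 := g.det_ne_zero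
  have hb0 : (g : Matrix (Fin 2) (Fin 2) ℂ) *ᵥ b ≠ 0 := by
    intro h
    exact hb (Matrix.eq_zero_of_mulVec_eq_zero hdet h)
  rw [smul_ratio g ha, ratio_eq_coe_iff] at ha'
  rw [smul_ratio g hb, ratio_eq_infty_iff] at hb'
  rw [smul_ratio g hc, ratio_eq_coe_iff] at hc'
  rw [smul_ratio g hd, ratio_eq_coe_iff] at hd'
  rw [← crossRatio_mulVec hdet]
  generalize (g : Matrix (Fin 2) (Fin 2) ℂ) *ᵥ a = a' at *
  generalize (g : Matrix (Fin 2) (Fin 2) ℂ) *ᵥ b = b' at *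
  generalize (g : Matrix (Fin 2) (Fin 2) ℂ) *ᵥ c = c' at *
  generalize (g : Matrix (Fin 2) (Fin 2) ℂ) *ᵥ d = d' at *
  obtain ⟨a1, a0⟩ := ha'
  obtain ⟨c1, c0⟩ := hc'
  obtain ⟨d1, d0⟩ := hd'
  have b0 : b' 0 ≠ 0 := fun h ↦ hb0 (funext fun i ↦ by fin_cases i <;> simp [h, hb'])
  simp only [crossRatio, wedge, a0, c0, d0, hb']
  rw [eq_div_iff (by simp [a1, b0, c1, d1])]
  ring

theorem exists_smul_ratio {a b c d : Fin 2 → ℂ} (ha : a ≠ 0) (hb : b ≠ 0) (hc : c ≠ 0)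
    (hd : d ≠ 0) (him : 0 < (crossRatio a b c d).im) :
    ∃ g : GL (Fin 2) ℂ, g • ratio a = ((0 : ℂ) : OnePoint ℂ) ∧ g • ratio b = OnePoint.infty ∧
      g • ratio c = ((1 : ℂ) : OnePoint ℂ) ∧
      g • ratio d = (crossRatio a b c d : OnePoint ℂ) := by
  have hne : crossRatio a b c d ≠ 0 := fun h ↦ by simp [h] at him
  have hne' := hne
  simp only [crossRatio, ne_eq, div_eq_zero_iff, mul_eq_zero, not_or] at hne'
  obtain ⟨⟨had, hbc⟩, hac, hbd⟩ := hne'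
  -- If a and b coincided projectively, the Plücker relation would make the cross-ratio equal to 1,
  -- which is real.
  have hab : wedge a b ≠ 0 := by
    intro h
    have hp := plucker a b c d
    rw [h, zero_mul, eq_comm, sub_eq_zero] at hp
    rw [crossRatio, ← hp, div_self (mul_ne_zero hac hbd)] at him
    simp at him
  -- The Möbius map with zero at a and pole at b, scaled to take the value 1 at c; `hMx` shows this
  -- form.
  let M : Matrix (Fin 2) (Fin 2) ℂ :=
    !![-(wedge b c * a 1), wedge b c * a 0; -(wedge a c * b 1), wedge a c * b 0]
  have hM : M.det ≠ 0 := by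
    have : M.det = wedge b c * wedge a c * wedge a b := by
      simp only [M, Matrix.det_fin_two_of]
      generalize wedge b c = r
      generalize wedge a c = s
      simp only [wedge]
      ring
    rw [this]
    exact mul_ne_zero (mul_ne_zero hbc hac) hab
  have hMx (x : Fin 2 → ℂ) : M *ᵥ x = ![wedge b c * wedge a x, wedge a c * wedge b x] := by
    rw [Matrix.mulVec_fin_two]
    simp only [M, wedge]
    ext i
    fin_cases i <;> simp <;> ring
  have hself (x : Fin 2 → ℂ) : wedge x x = 0 := by simp [wedge, mul_comm]
  refine ⟨Matrix.GeneralLinearGroup.mkOfDetNeZero M hM, ?_, ?_, ?_, ?_⟩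
  · rw [smul_ratio _ ha, ratio_eq_coe_iff]
    change (M *ᵥ a) 1 ≠ 0 ∧ (M *ᵥ a) 0 = 0 * (M *ᵥ a) 1
    rw [hMx, hself, wedge_swap a b]
    simp [hac, hab]
  · rw [smul_ratio _ hb, ratio_eq_infty_iff]
    change (M *ᵥ b) 1 = 0
    rw [hMx, hself]
    simp
  · rw [smul_ratio _ hc, ratio_eq_coe_iff]
    change (M *ᵥ c) 1 ≠ 0 ∧ (M *ᵥ c) 0 = 1 * (M *ᵥ c) 1
    rw [hMx]
    simp [hac, hbc, mul_comm]
  · rw [smul_ratio _ hd, ratio_eq_coe_iff]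
    change (M *ᵥ d) 1 ≠ 0 ∧ (M *ᵥ d) 0 = crossRatio a b c d * (M *ᵥ d) 1
    rw [hMx, crossRatio]
    simp only [Matrix.cons_val_zero, Matrix.cons_val_one]
    refine ⟨mul_ne_zero hac hbd, ?_⟩
    field_simp

/-! ### Shape parameters and orientation of an ideal tetrahedron -/

section Tetrahedron

variable {v : Fin 4 → OnePoint ℂ} {x : Fin 4 → Fin 2 → ℂ}

/-- Interchanging 0 and ∞ is absorbed by also interchanging the other two points, which leaves the
cross-ratio unchanged. -/
theorem isShapeParameter_iff (hx : ∀ i, x i ≠ 0) (hv : ∀ i, v i = ratio (x i)) {i j : Fin 4}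
    {z : ℂ} : IsShapeParameter v i j z ↔
      0 < z.im ∧ ∃ k l, [i, j, k, l].Nodup ∧ z = crossRatio (x i) (x j) (x k) (x l) := by
  simp only [IsShapeParameter, hv]
  refine and_congr_right fun hz ↦ ⟨?_, ?_⟩
  · rintro ⟨g, k, l, hn, ⟨hi, hj⟩ | ⟨hi, hj⟩, hk, hl⟩
    · exact ⟨k, l, hn, crossRatio_eq_of_ratio_eq (hx i) (hx j) (hx k) (hx l) hi hj hk hl⟩
    · refine ⟨l, k, ?_, ?_⟩
      · simp only [List.nodup_cons, List.mem_cons, not_or] at hn ⊢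
        tauto
      · rw [crossRatio_eq_of_ratio_eq (hx j) (hx i) (hx k) (hx l) hj hi hk hl,
          crossRatio_swap_swap]
  · rintro ⟨k, l, hn, rfl⟩
    obtain ⟨g, h0, h1, h2, h3⟩ := exists_smul_ratio (hx i) (hx j) (hx k) (hx l) hz
    exact ⟨g, k, l, hn, Or.inl ⟨h0, h1⟩, h2, h3⟩

theorem IsShapeParameter.symm {i j : Fin 4} {z : ℂ} (h : IsShapeParameter v i j z) :
    IsShapeParameter v j i z := by
  obtain ⟨hz, g, k, l, hn, hij, hk, hl⟩ := h
  refine ⟨hz, g, k, l, (List.Perm.swap _ _ _).nodup hn, ?_, hk, hl⟩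
  tauto

/-- The two labellings of the remaining vertices give inverse cross-ratios, and z and 1/z cannot
both lie in the upper half-plane. -/
theorem IsShapeParameter.unique (hx : ∀ i, x i ≠ 0) (hv : ∀ i, v i = ratio (x i)) {i j : Fin 4}
    {z w : ℂ} (hz : IsShapeParameter v i j z) (hw : IsShapeParameter v i j w) : z = w := by
  rw [isShapeParameter_iff hx hv] at hz hw
  obtain ⟨hz, k, l, hn, rfl⟩ := hz
  obtain ⟨hw, k', l', hn', rfl⟩ := hw
  have : (k' = k ∧ l' = l) ∨ (k' = l ∧ l' = k) := by
    revert i j k l k' l'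
    simp only [List.nodup_cons, List.mem_cons, not_or, List.not_mem_nil]
    intros
    omega
  obtain ⟨rfl, rfl⟩ | ⟨rfl, rfl⟩ := this
  · rfl
  · rw [crossRatio_swap, Complex.inv_im] at hw
    have := div_nonpos_of_nonpos_of_nonneg (neg_nonpos.2 hz.le) (Complex.normSq_nonneg
      (crossRatio (x i) (x j) (x l') (x k')))
    exact absurd hw this.not_gt

/-- Homogeneous form of inverse stereographic projection, uniform at ∞. -/
theorem toSphere_ratio {a : Fin 2 → ℂ} (ha : a ≠ 0) :
    toSphere (ratio a) = (Complex.normSq (a 0) + Complex.normSq (a 1))⁻¹ •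
      ![2 * (a 0 * star (a 1)).re, 2 * (a 0 * star (a 1)).im,
        Complex.normSq (a 0) - Complex.normSq (a 1)] := by
  by_cases h : a 1 = 0
  · have h0 : a 0 ≠ 0 := fun h0 ↦ ha (funext fun i ↦ by fin_cases i <;> simp [h0, h])
    rw [ratio, if_pos h]
    change ![0, 0, 1] = _
    ext i
    fin_cases i <;> simp [h, h0]
  · rw [ratio, if_neg h]
    change ![2 * (a 0 / a 1).re / (Complex.normSq (a 0 / a 1) + 1),
      2 * (a 0 / a 1).im / (Complex.normSq (a 0 / a 1) + 1),
      (Complex.normSq (a 0 / a 1) - 1) / (Complex.normSq (a 0 / a 1) + 1)] = _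
    have hp := Complex.normSq_pos.2 h
    have hn := Complex.normSq_nonneg (a 0)
    have hs : Complex.normSq (a 0) + Complex.normSq (a 1) ≠ 0 := by positivity
    have hre : (a 0 / a 1).re = (a 0 * star (a 1)).re / Complex.normSq (a 1) := by
      rw [Complex.div_re]; simp; ring
    have him : (a 0 / a 1).im = (a 0 * star (a 1)).im / Complex.normSq (a 1) := by
      rw [Complex.div_im]; simp; ring
    have hp' := hp.ne'
    rw [hre, him, Complex.normSq_div]
    ext i
    fin_cases i <;> simp <;> field_simp

theorem triple_product_toSphere (hx : ∀ i, x i ≠ 0) :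
    (toSphere (ratio (x 0)) - toSphere (ratio (x 1))) ⬝ᵥ
      ((toSphere (ratio (x 2)) - toSphere (ratio (x 1))) ⨯₃
        (toSphere (ratio (x 3)) - toSphere (ratio (x 1)))) *
      ∏ i, (Complex.normSq (x i 0) + Complex.normSq (x i 1)) =
    8 * (wedge (x 0) (x 2) * wedge (x 1) (x 3) *
      star (wedge (x 0) (x 3) * wedge (x 1) (x 2))).im := by
  have hN (i) : Complex.normSq (x i 0) + Complex.normSq (x i 1) ≠ 0 := by
    intro h
    have h0 := Complex.normSq_nonneg (x i 0)
    have h1 := Complex.normSq_nonneg (x i 1)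
    have e0 : x i 0 = 0 := Complex.normSq_eq_zero.1 (by linarith)
    have e1 : x i 1 = 0 := Complex.normSq_eq_zero.1 (by linarith)
    exact hx i (funext fun j ↦ by fin_cases j <;> simp [e0, e1])
  -- The triple product of differences is a signed sum of four triple products, each omitting one
  -- vertex; clearing denominators here leaves a polynomial identity in the spinor entries.
  have general (s : Fin 4 → Fin 3 → ℝ) (n : Fin 4 → ℝ) (hn : ∀ i, n i ≠ 0) :
      ((n 0)⁻¹ • s 0 - (n 1)⁻¹ • s 1) ⬝ᵥ (((n 2)⁻¹ • s 2 - (n 1)⁻¹ • s 1) ⨯₃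
        ((n 3)⁻¹ • s 3 - (n 1)⁻¹ • s 1)) * (n 0 * n 1 * n 2 * n 3) =
      n 1 * (s 0 ⬝ᵥ (s 2 ⨯₃ s 3)) - n 3 * (s 0 ⬝ᵥ (s 2 ⨯₃ s 1)) - n 2 * (s 0 ⬝ᵥ (s 1 ⨯₃ s 3)) -
        n 0 * (s 1 ⬝ᵥ (s 2 ⨯₃ s 3)) := by
    have := hn 0
    have := hn 1
    have := hn 2
    have := hn 3
    simp only [cross_apply, Matrix.vec3_dotProduct, Pi.sub_apply, Pi.smul_apply, smul_eq_mul,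
      Matrix.cons_val]
    field_simp
    ring
  rw [Fin.prod_univ_four]
  simp only [toSphere_ratio (hx _)]
  rw [general (fun i ↦ ![2 * (x i 0 * star (x i 1)).re, 2 * (x i 0 * star (x i 1)).im,
        Complex.normSq (x i 0) - Complex.normSq (x i 1)]) _ hN]
  simp only [cross_apply, Matrix.vec3_dotProduct, Matrix.cons_val, wedge, RCLike.star_def,
    map_mul, map_sub, Complex.mul_re, Complex.mul_im, Complex.sub_re, Complex.sub_im,
    Complex.conj_re, Complex.conj_im, Complex.normSq_apply]
  ring

/-- The imaginary part of a/b has the sign of that of a·b̄, which is the triple product up to a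
positive factor. The order 3, 2 puts vertex 3 at 1 and vertex 2 at z. -/
theorem PositivelyNumbered.im_crossRatio_pos (h : PositivelyNumbered v) (hx : ∀ i, x i ≠ 0)
    (hv : ∀ i, v i = ratio (x i)) : 0 < (crossRatio (x 0) (x 1) (x 3) (x 2)).im := by
  simp only [PositivelyNumbered, hv] at h
  have e := triple_product_toSphere hx
  have hN : 0 < ∏ i, (Complex.normSq (x i 0) + Complex.normSq (x i 1)) := by
    refine Finset.prod_pos fun i _ ↦ ?_
    have h0 := Complex.normSq_nonneg (x i 0)
    have h1 := Complex.normSq_nonneg (x i 1)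
    refine lt_of_le_of_ne (by positivity) fun h ↦ ?_
    have e0 : x i 0 = 0 := Complex.normSq_eq_zero.1 (by linarith)
    have e1 : x i 1 = 0 := Complex.normSq_eq_zero.1 (by linarith)
    exact hx i (funext fun j ↦ by fin_cases j <;> simp [e0, e1])
  have hpos := mul_pos h hN
  rw [e] at hpos
  rw [crossRatio]
  generalize wedge (x 0) (x 2) * wedge (x 1) (x 3) = a at *
  generalize wedge (x 0) (x 3) * wedge (x 1) (x 2) = b at *
  have hb : b ≠ 0 := by rintro rfl; simp at hpos
  have hdiv : (a / b).im = (a * star b).im / Complex.normSq b := by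
    rw [Complex.div_im]; simp; ring
  rw [hdiv]
  exact div_pos (by linarith) (Complex.normSq_pos.2 hb)

/-- The six shape parameters of a positively numbered ideal tetrahedron. -/
theorem isShapeParameter_crossRatio (hx : ∀ i, x i ≠ 0) (hv : ∀ i, v i = ratio (x i))
    (h : PositivelyNumbered v) {d : Fin 4 → Fin 4 → ℂ} (hd : ∀ i j, d i j = wedge (x i) (x j)) :
    (IsShapeParameter v 0 1 (d 0 2 * d 1 3 / (d 0 3 * d 1 2)) ∧
      IsShapeParameter v 2 3 (d 0 2 * d 1 3 / (d 0 3 * d 1 2))) ∧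
    (IsShapeParameter v 0 2 (-(d 0 3 * d 1 2 / (d 0 1 * d 2 3))) ∧
      IsShapeParameter v 1 3 (-(d 0 3 * d 1 2 / (d 0 1 * d 2 3)))) ∧
    (IsShapeParameter v 0 3 (d 0 1 * d 2 3 / (d 0 2 * d 1 3)) ∧
      IsShapeParameter v 1 2 (d 0 1 * d 2 3 / (d 0 2 * d 1 3))) := by
  have hω := h.im_crossRatio_pos hx hv
  have hne : crossRatio (x 0) (x 1) (x 3) (x 2) ≠ 0 := fun h ↦ by simp [h] at hω
  rw [crossRatio] at hω hne
  have hp := plucker (x 0) (x 1) (x 2) (x 3)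
  have hs (i j) : wedge (x j) (x i) = -wedge (x i) (x j) := wedge_swap _ _
  simp only [ne_eq, div_eq_zero_iff, not_or] at hne
  obtain ⟨hn, hm⟩ := hne
  -- With z = a/b, Plücker gives a - b for the third product, so the other two parameters are 1/(1 -
  -- z) and 1 - 1/z. Both maps preserve the upper half-plane.
  have him2 : 0 < (-(wedge (x 0) (x 3) * wedge (x 1) (x 2) /
      (wedge (x 0) (x 1) * wedge (x 2) (x 3)))).im := by
    rw [hp]
    generalize wedge (x 0) (x 2) * wedge (x 1) (x 3) = a at *
    generalize wedge (x 0) (x 3) * wedge (x 1) (x 2) = b at *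
    have hne : a / b - 1 ≠ 0 := fun h ↦ by
      rw [sub_eq_zero.1 h] at hω
      simp at hω
    have hab : -(b / (a - b)) = -(a / b - 1)⁻¹ := by
      rw [← inv_div, sub_div, div_self hm]
    rw [hab, Complex.neg_im, Complex.inv_im, neg_div, neg_neg]
    exact div_pos (by simpa using hω) (Complex.normSq_pos.2 hne)
  have him3 : 0 < (wedge (x 0) (x 1) * wedge (x 2) (x 3) /
      (wedge (x 0) (x 2) * wedge (x 1) (x 3))).im := by
    rw [hp]
    generalize wedge (x 0) (x 2) * wedge (x 1) (x 3) = a at *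
    generalize wedge (x 0) (x 3) * wedge (x 1) (x 2) = b at *
    have hab : (a - b) / a = 1 - (a / b)⁻¹ := by
      rw [inv_div, sub_div, div_self hn]
    rw [hab, Complex.sub_im, Complex.inv_im, neg_div, sub_neg_eq_add]
    have := div_pos hω (Complex.normSq_pos.2 (div_ne_zero hn hm))
    simpa using this
  simp only [isShapeParameter_iff hx hv, hd]
  -- The second label of each pair is the vertex sent to z. The number of index pairs to reverse is
  -- odd only for edges 02 and 13, whence their minus sign.
  refine ⟨⟨⟨hω, 3, 2, by decide, ?_⟩, ⟨hω, 1, 0, by decide, ?_⟩⟩,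
    ⟨⟨him2, 1, 3, by decide, ?_⟩, ⟨him2, 0, 2, by decide, ?_⟩⟩,
    ⟨⟨him3, 2, 1, by decide, ?_⟩, ⟨him3, 3, 0, by decide, ?_⟩⟩⟩
  · rfl
  · rw [crossRatio, hs 0 2, hs 1 3, hs 1 2, hs 0 3]; ring
  · rw [crossRatio, hs 1 2]; ring
  · rw [crossRatio, hs 0 3, hs 0 1, hs 2 3]; ring
  · rw [crossRatio, hs 2 3, hs 1 3]; ring
  · rw [crossRatio, hs 0 1, hs 0 2]; ring

end Tetrahedron

end SpinHyperbolic

end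

theorem mainTheorem5
    (v : Fin 4 → OnePoint ℂ) (hv : SpinHyperbolic.PositivelyNumbered v)
    (D : Fin 4 → SpinHyperbolic.SpinDecoratedHorosphere) (hD : ∀ i, (D i).centre = v i) :
    (∀ i j, i ≠ j → ∃! z : ℂ, SpinHyperbolic.IsShapeParameter v i j z) ∧
    (∀ i j, ∃! l : ℂ, SpinHyperbolic.IsComplexLambdaLength (D i) (D j) l) ∧
    ∀ z l : Fin 4 → Fin 4 → ℂ,
      (∀ i j, i ≠ j → SpinHyperbolic.IsShapeParameter v i j (z i j)) →
      (∀ i j, SpinHyperbolic.IsComplexLambdaLength (D i) (D j) (l i j)) →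
      (z 0 1 = l 0 2 * l 1 3 / (l 0 3 * l 1 2) ∧ z 2 3 = l 0 2 * l 1 3 / (l 0 3 * l 1 2)) ∧
      (z 0 2 = -(l 0 3 * l 1 2 / (l 0 1 * l 2 3)) ∧
        z 1 3 = -(l 0 3 * l 1 2 / (l 0 1 * l 2 3))) ∧
      (z 0 3 = l 0 1 * l 2 3 / (l 0 2 * l 1 3) ∧ z 1 2 = l 0 1 * l 2 3 / (l 0 2 * l 1 3)) := by
  have hx (i) : (D i).spinor ≠ 0 := (D i).spinor_ne_zero
  have hr (i) : v i = SpinHyperbolic.ratio (D i).spinor := by rw [← hD, (D i).centre_eq_ratio]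
  refine ⟨fun i j hij ↦ ?_, fun i j ↦ ?_, fun z l hz hl ↦ ?_⟩
  · refine existsUnique_of_exists_of_unique ?_ fun _ _ h h' ↦ h.unique hx hr h'
    obtain ⟨⟨h01, h23⟩, ⟨h02, h13⟩, h03, h12⟩ :=
      SpinHyperbolic.isShapeParameter_crossRatio hx hr hv fun _ _ ↦ rfl
    fin_cases i <;> fin_cases j <;> first
      | exact absurd rfl hij
      | exact ⟨_, h01⟩ | exact ⟨_, h02⟩ | exact ⟨_, h03⟩
      | exact ⟨_, h12⟩ | exact ⟨_, h13⟩ | exact ⟨_, h23⟩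
      | exact ⟨_, h01.symm⟩ | exact ⟨_, h02.symm⟩ | exact ⟨_, h03.symm⟩
      | exact ⟨_, h12.symm⟩ | exact ⟨_, h13.symm⟩ | exact ⟨_, h23.symm⟩
  · simp only [SpinHyperbolic.isComplexLambdaLength_iff, existsUnique_eq]
  · obtain ⟨⟨h01, h23⟩, ⟨h02, h13⟩, h03, h12⟩ :=
      SpinHyperbolic.isShapeParameter_crossRatio hx hr hv fun i j ↦
        (SpinHyperbolic.isComplexLambdaLength_iff _ _ _).1 (hl i j)
    exact ⟨⟨(hz 0 1 (by decide)).unique hx hr h01, (hz 2 3 (by decide)).unique hx hr h23⟩,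
      ⟨(hz 0 2 (by decide)).unique hx hr h02, (hz 1 3 (by decide)).unique hx hr h13⟩,
      (hz 0 3 (by decide)).unique hx hr h03, (hz 1 2 (by decide)).unique hx hr h12⟩
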